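/- Let $k=\mathbb F_q$ be a finite field with $q$ elements. A Kronecker module over $k$ is a pair of finite-dimensional $k$-vector spaces $(V_1,V_2)$ with two linear maps $\alpha,\beta\colon V_2\to V_1$; its dimension vector is $(\dim V_1,\dim V_2)$; a submodule is a pair of subspaces $W_1\subseteq V_1$, $W_2\subseteq V_2$ with $\alpha(W_2)+\beta(W_2)\subseteq W_1$. For integers $l,a$ let $$G^l_a(q)=\frac{(q^a-1)(q^{a-1}-1)\cdots(q^{a-l+1}-1)}{(q^l-1)(q^{l-1}-1)\cdots(q-1)}\ \ (l>0),\qquad G^0_a(q)=1,\qquad G^l_a(q)=0\ \ (l<0).$$ Theorem 4.1. Let $n\ge 0$ be an integer. There exists an indecomposable Kronecker module over $k$ of dimension vector $(n+1,n)$. Let $P_n$ be any such module (the preprojective indecomposable Kronecker module of this dimension vector). For all integers $a,b$, the set $Gr_{(a,b)}(P_n)$ of submodules of $P_n$ of dimension vector $(a,b)$ is finite, and $$|Gr_{(a,b)}(P_n)|=\begin{cases}0 & \text{if } a<0 \text{ or } b<0,\\ 1 & \text{if } a=b=0,\\ G^{n+1-a}_{n+1-b}(q)\,G^{a-b-1}_{a-1}(q)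 & \text{otherwise.}\end{cases}$$ -/

import Mathlib

universe u v

/-- A finite-dimensional module over the path algebra of the Kronecker quiver with two arrows
`α, β : 2 → 1`, given as a representation: a finite-dimensional vector space at each of the two
vertices and a linear map `V₂ → V₁` for each of the two arrows. -/
structure KroneckerModule (k : Type u) [Field k] where
  V₁ : Type v
  V₂ : Type v
  [addCommGroup₁ : AddCommGroup V₁]
  [addCommGroup₂ : AddCommGroup V₂]
  [module₁ : Module k V₁]
  [module₂ : Module k V₂]
  [finite₁ : Module.Finite k V₁]
  [finite₂ : Module.Finite k V₂]
  α : V₂ →ₗ[k] V₁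
  β : V₂ →ₗ[k] V₁

namespace KroneckerModule

attribute [instance] addCommGroup₁ addCommGroup₂ module₁ module₂ finite₁ finite₂

variable {k : Type u} [Field k]

/-- The dimension vector `(dim V₁, dim V₂)`. -/
noncomputable def dimVector (M : KroneckerModule.{u, v} k) : ℕ × ℕ :=
  (Module.finrank k M.V₁, Module.finrank k M.V₂)

/-- A submodule (subrepresentation): a pair of subspaces `W₁ ≤ V₁`, `W₂ ≤ V₂` such that both arrows
map `W₂` into `W₁`. -/
structure Sub (M : KroneckerModule.{u, v} k) where
  W₁ : Submodule k M.V₁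
  W₂ : Submodule k M.V₂
  map_α : ∀ x ∈ W₂, M.α x ∈ W₁
  map_β : ∀ x ∈ W₂, M.β x ∈ W₁

namespace Sub

variable {M : KroneckerModule.{u, v} k}

/-- A submodule regarded as a Kronecker module in its own right. -/
def toKroneckerModule (N : M.Sub) : KroneckerModule.{u, v} k where
  V₁ := N.W₁
  V₂ := N.W₂
  α := M.α.restrict N.map_α
  β := M.β.restrict N.map_β

/-- The submodule is zero. -/
def IsZero (N : M.Sub) : Prop := N.W₁ = ⊥ ∧ N.W₂ = ⊥

/-- `M` is the internal direct sum of the submodules `N` and `N'`. -/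
def IsComplement (N N' : M.Sub) : Prop := IsCompl N.W₁ N'.W₁ ∧ IsCompl N.W₂ N'.W₂

end Sub

/-- `M` is indecomposable: it is nonzero, and in every direct sum decomposition `M = N ⊕ N'` one of
the summands is zero. -/
def IsIndecomposable (M : KroneckerModule.{u, v} k) : Prop :=
  (Nontrivial M.V₁ ∨ Nontrivial M.V₂) ∧
    ∀ N N' : M.Sub, N.IsComplement N' → N.IsZero ∨ N'.IsZero

/-- The quiver Grassmannian `Gr_{(a,b)}(M)`: the set of submodules of `M` of dimension vector
`(a, b)`, for arbitrary integers `a, b` (it is empty if one of them is negative). -/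
def grassmannian (M : KroneckerModule.{u, v} k) (a b : ℤ) : Set M.Sub :=
  {N | (N.toKroneckerModule.dimVector.1 : ℤ) = a ∧ (N.toKroneckerModule.dimVector.2 : ℤ) = b}

end KroneckerModule

/-- The Gaussian coefficient `G^l_a(q)` for arbitrary integers `l, a`: for `l > 0` it is
`((q^a - 1) ⋯ (q^(a-l+1) - 1)) / ((q^l - 1) ⋯ (q - 1))`; it is `1` for `l = 0` and `0` for
`l < 0`. -/
noncomputable def gaussCoeff (l a : ℤ) (q : ℚ) : ℚ :=
  if l < 0 then 0
  else (∏ i ∈ Finset.range l.toNat, (q ^ (a - (i : ℤ)) - 1)) /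
    ∏ i ∈ Finset.range l.toNat, (q ^ (i + 1) - 1)

/-!
No classification of indecomposable modules is used; the count is an induction on `n` through the
reflection functor.

For a Kronecker module `M` let `c(a, d)` be the number of `a`-dimensional subspaces `W` of `V₁` for
which `α⁻¹ W ∩ β⁻¹ W` has dimension `d`. A submodule with first component `W` is a subspace of
`α⁻¹ W ∩ β⁻¹ W`, so `|Gr_{(a,b)}(M)| = ∑ d, c(a, d) [d, b]_q`. The matrix of the Gaussian
binomials `[d, b]_q` is unitriangular, so the numbers `|Gr_{(a,b)}(M)|` for all `b` determine the
numbers `c(a, d)` (`KroneckerModule.prolongNumber_eq`).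

Submodules can also be counted through their second component `W ≤ V₂`: the first component is any
`a`-dimensional subspace containing `α W + β W`. The kernel of `(α, β) : W × W → V₁` is the space
`α⁻¹ W ∩ β⁻¹ W` formed in the reflection `M' = (V₂, ker ((α, β) : V₂ × V₂ → V₁))`, so
`dim (α W + β W) = 2 dim W - d` where `d` is the dimension of that space
(`KroneckerModule.finrank_image_add_finrank_preimage`). Hence the numbers `c` of `M'` give the
counts for `M`. If `M` is indecomposable of dimension vector `(n + 2, n + 1)`, then `M'` is
indecomposable of dimension vector `(n + 1, n)` (`KroneckerModule.IsIndecomposable.reflection`),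
so everything is determined recursively. That the closed formulas satisfy the two relations is the
`q`-Vandermonde identity (`sum_prolongCount_mul_qBinom`, `sum_prolongCount_mul_qBinom'`).

Existence: polynomials of degree `≤ n` and `< n`, with the inclusion and multiplication by `X`.
There every nonzero submodule has `dim W₁ > dim W₂`, so two nonzero summands would force
`dim V₁ ≥ dim V₂ + 2`.
-/

open Module

/-! ### Gaussian binomial coefficients -/

/-- The Gaussian binomial coefficient `[n, k]_q` for natural numbers, defined by the `q`-Pascal
rule; in particular it is `0` for `k > n`. -/
def qBinom (q : ℕ) : ℕ → ℕ → ℕ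
  | _, 0 => 1
  | 0, _ + 1 => 0
  | n + 1, k + 1 => qBinom q n k + q ^ (k + 1) * qBinom q n (k + 1)

@[simp] theorem qBinom_zero_right (q n : ℕ) : qBinom q n 0 = 1 := by
  cases n <;> rfl

@[simp] theorem qBinom_zero_succ (q k : ℕ) : qBinom q 0 (k + 1) = 0 := rfl

theorem qBinom_succ_succ (q n k : ℕ) :
    qBinom q (n + 1) (k + 1) = qBinom q n k + q ^ (k + 1) * qBinom q n (k + 1) := rfl

theorem qBinom_eq_zero (q : ℕ) : ∀ {n k : ℕ}, n < k → qBinom q n k = 0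
  | 0, k + 1, _ => rfl
  | n + 1, k + 1, h => by
    rw [qBinom_succ_succ, qBinom_eq_zero q (by omega), qBinom_eq_zero q (by omega), mul_zero,
      add_zero]

@[simp] theorem qBinom_self (q : ℕ) : ∀ n : ℕ, qBinom q n n = 1
  | 0 => rfl
  | n + 1 => by
    rw [qBinom_succ_succ, qBinom_self q n, qBinom_eq_zero q (by omega), mul_zero, add_zero]

/-- The unnormalised `q`-factorial `(q - 1)(q² - 1) ⋯ (qⁿ - 1)`. -/
def qFact (q n : ℕ) : ℚ := ∏ i ∈ Finset.range n, ((q : ℚ) ^ (i + 1) - 1)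

@[simp] theorem qFact_zero (q : ℕ) : qFact q 0 = 1 := by simp [qFact]

theorem qFact_succ (q n : ℕ) : qFact q (n + 1) = qFact q n * ((q : ℚ) ^ (n + 1) - 1) := by
  simp [qFact, Finset.prod_range_succ]

theorem qFact_ne_zero {q : ℕ} (hq : 1 < q) (n : ℕ) : qFact q n ≠ 0 := by
  refine Finset.prod_ne_zero_iff.2 fun i _ => ne_of_gt ?_
  have : (1 : ℚ) < (q : ℚ) ^ (i + 1) := one_lt_pow₀ (by exact_mod_cast hq) (by omega)
  linarith

theorem qBinom_mul_qFact (q : ℕ) :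
    ∀ i j : ℕ, (qBinom q (i + j) i : ℚ) * (qFact q i * qFact q j) = qFact q (i + j)
  | 0, j => by simp
  | i + 1, 0 => by simp
  | i + 1, j + 1 => by
    have h₁ := qBinom_mul_qFact q i (j + 1)
    have h₂ := qBinom_mul_qFact q (i + 1) j
    rw [show i + (j + 1) = i + j + 1 by ring] at h₁
    rw [show i + 1 + j = i + j + 1 by ring] at h₂
    rw [show i + 1 + (j + 1) = i + j + 1 + 1 by ring, qBinom_succ_succ,
      qFact_succ q (i + j + 1)]
    rw [qFact_succ q j] at h₁ ⊢
    rw [qFact_succ q i] at h₂ ⊢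
    push_cast
    linear_combination ((q : ℚ) ^ (i + 1) - 1) * h₁ +
      (q : ℚ) ^ (i + 1) * ((q : ℚ) ^ (j + 1) - 1) * h₂

theorem qBinom_eq_div {q : ℕ} (hq : 1 < q) (i j : ℕ) :
    (qBinom q (i + j) i : ℚ) = qFact q (i + j) / (qFact q i * qFact q j) := by
  rw [eq_div_iff (mul_ne_zero (qFact_ne_zero hq i) (qFact_ne_zero hq j)), qBinom_mul_qFact]

/-- The second form of the `q`-Pascal rule. -/
theorem qBinom_succ_succ' {q : ℕ} (hq : 1 < q) (i j : ℕ) :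
    qBinom q (i + j + 1) (i + 1) =
      qBinom q (i + j) (i + 1) + q ^ j * qBinom q (i + j) i := by
  rcases j with _ | j
  · simp [qBinom_eq_zero q (Nat.lt_succ_self i)]
  have h₀ := qBinom_eq_div hq (i + 1) (j + 1)
  have h₁ := qBinom_eq_div hq i (j + 1)
  have h₂ := qBinom_eq_div hq (i + 1) j
  rw [show i + 1 + (j + 1) = i + (j + 1) + 1 by ring] at h₀
  rw [show i + 1 + j = i + (j + 1) by ring] at h₂
  have : (qBinom q (i + (j + 1) + 1) (i + 1) : ℚ) = qBinom q (i + (j + 1)) (i + 1) +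
      q ^ (j + 1) * qBinom q (i + (j + 1)) i := by
    rw [h₀, h₁, h₂, qFact_succ q (i + (j + 1)), qFact_succ q i, qFact_succ q j]
    have e₁ := qFact_ne_zero hq i
    have e₂ := qFact_ne_zero hq j
    have e₃ := qFact_ne_zero hq (i + 1)
    have e₄ := qFact_ne_zero hq (j + 1)
    rw [qFact_succ] at e₃ e₄
    have e₅ := right_ne_zero_of_mul e₃
    have e₆ := right_ne_zero_of_mul e₄
    field_simp
    ring
  exact_mod_cast this

theorem qBinom_mul_qBinom {q : ℕ} (hq : 1 < q) (n : ℕ) {k s : ℕ} (h' : s ≤ k) :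
    qBinom q n k * qBinom q k s = qBinom q n s * qBinom q (n - s) (k - s) := by
  rcases lt_or_ge n k with h | h
  · rcases lt_or_ge n s with hs | hs
    · rw [qBinom_eq_zero q h, qBinom_eq_zero q hs, zero_mul, zero_mul]
    · rw [qBinom_eq_zero q h, qBinom_eq_zero q (show n - s < k - s by omega), zero_mul, mul_zero]
  obtain ⟨t, rfl⟩ := Nat.exists_eq_add_of_le h'
  obtain ⟨r, rfl⟩ := Nat.exists_eq_add_of_le h
  have h₁ := qBinom_eq_div hq (s + t) r
  have h₂ := qBinom_eq_div hq s t
  have h₃ := qBinom_eq_div hq s (t + r)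
  have h₄ := qBinom_eq_div hq t r
  rw [show s + t + r - s = t + r by omega, show s + t - s = t by omega]
  rw [← add_assoc] at h₃
  have : (qBinom q (s + t + r) (s + t) : ℚ) * qBinom q (s + t) s =
      qBinom q (s + t + r) s * qBinom q (t + r) t := by
    rw [h₁, h₂, h₃, h₄]
    have e₁ := qFact_ne_zero hq s
    have e₂ := qFact_ne_zero hq t
    have e₃ := qFact_ne_zero hq r
    have e₄ := qFact_ne_zero hq (s + t)
    have e₅ := qFact_ne_zero hq (t + r)
    field_simp
  exact_mod_cast this

/-- The `q`-Vandermonde identity. Where the exponent is truncated, the term vanishes. -/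
theorem qBinom_add {q : ℕ} (hq : 1 < q) (m n k : ℕ) :
    qBinom q (m + n) k = ∑ p ∈ Finset.HasAntidiagonal.antidiagonal k,
      qBinom q m p.1 * qBinom q n p.2 * q ^ (p.2 * (m - p.1)) := by
  induction n generalizing k with
  | zero =>
    rw [Finset.sum_eq_single (k, 0)]
    · simp
    · rintro ⟨i, j⟩ h h'
      rw [Finset.HasAntidiagonal.mem_antidiagonal] at h
      rcases j with _ | j
      · simp_all
      · simp
    · simp
  | succ n ih =>
    rcases k with _ | k
    · simp
    rw [Finset.Nat.sum_antidiagonal_succ']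
    have hterm : ∀ p ∈ Finset.HasAntidiagonal.antidiagonal k,
        qBinom q m p.1 * qBinom q (n + 1) (p.2 + 1) * q ^ ((p.2 + 1) * (m - p.1)) =
        qBinom q m p.1 * qBinom q n (p.2 + 1) * q ^ ((p.2 + 1) * (m - p.1)) +
        q ^ (m + n - k) * (qBinom q m p.1 * qBinom q n p.2 * q ^ (p.2 * (m - p.1))) := by
      rintro ⟨i, j⟩ h
      rw [Finset.HasAntidiagonal.mem_antidiagonal] at h
      dsimp only at h ⊢
      rcases lt_or_ge m i with hi | hi
      · simp [qBinom_eq_zero q hi]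
      rcases lt_or_ge n j with hj | hj
      · simp [qBinom_eq_zero q hj, qBinom_eq_zero q (show n < j + 1 by omega),
          qBinom_eq_zero q (show n + 1 < j + 1 by omega)]
      obtain ⟨t, rfl⟩ := Nat.exists_eq_add_of_le hi
      obtain ⟨r, rfl⟩ := Nat.exists_eq_add_of_le hj
      rw [qBinom_succ_succ' hq, show i + t - i = t by omega,
        show i + t + (j + r) - k = t + r by omega]
      ring
    rw [Finset.sum_congr rfl hterm, Finset.sum_add_distrib, ← Finset.mul_sum, ← ih k]
    have h2 := ih (k + 1)
    rw [Finset.Nat.sum_antidiagonal_succ'] at h2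
    have h3 : qBinom q (m + (n + 1)) (k + 1) =
        qBinom q (m + n) (k + 1) + q ^ (m + n - k) * qBinom q (m + n) k := by
      rcases lt_or_ge (m + n) k with h | h
      · rw [qBinom_eq_zero q h, qBinom_eq_zero q (by omega), qBinom_eq_zero q (by omega),
          mul_zero, add_zero]
      · obtain ⟨j, hj⟩ := Nat.exists_eq_add_of_le h
        rw [← add_assoc, hj, qBinom_succ_succ' hq]
        simp
    rw [h3, h2]
    simp only [qBinom_zero_right, zero_mul, pow_zero]
    ring

theorem gaussCoeff_natCast {q : ℕ} (hq : 1 < q) {l a : ℕ} (h : l ≤ a) :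
    gaussCoeff l a q = qBinom q a l := by
  obtain ⟨j, rfl⟩ := Nat.exists_eq_add_of_le h
  rw [qBinom_eq_div hq, gaussCoeff, if_neg (by omega), Int.toNat_natCast]
  have key : ∀ l : ℕ, (∏ i ∈ Finset.range l, ((q : ℚ) ^ (((l + j : ℕ) : ℤ) - (i : ℤ)) - 1)) *
      qFact q j = qFact q (l + j) := by
    intro l
    -- The factors with `i ≥ 1` are those of the product for `l`.
    induction l with
    | zero => simp
    | succ l ih =>
      rw [Finset.prod_range_succ', show l + 1 + j = l + j + 1 by ring, qFact_succ, ← ih]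
      have e : ∀ i : ℕ, ((l + j + 1 : ℕ) : ℤ) - ((i + 1 : ℕ) : ℤ) = ((l + j : ℕ) : ℤ) - i := by
        intro i; push_cast; ring
      simp only [e]
      rw [Nat.cast_zero, sub_zero, zpow_natCast]
      ring
  rw [← key l]
  have e₁ := qFact_ne_zero hq l
  have e₂ := qFact_ne_zero hq j
  change _ / qFact q l = _
  field_simp

theorem gaussCoeff_eq_zero_of_neg {l : ℤ} (a : ℤ) (q : ℚ) (h : l < 0) : gaussCoeff l a q = 0 :=
  if_pos h

theorem qBinom_symm {q : ℕ} (hq : 1 < q) (i j : ℕ) :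
    qBinom q (i + j) i = qBinom q (i + j) j := by
  have h₁ := qBinom_eq_div hq i j
  have h₂ := qBinom_eq_div hq j i
  rw [add_comm j i, mul_comm, ← h₁] at h₂
  exact_mod_cast h₂.symm

/-- Uniqueness in `q`-binomial inversion: the matrix of the `[d, b]_q` is unitriangular. -/
theorem eq_of_sum_mul_qBinom_eq (q : ℕ) (c c' : ℕ → ℕ) (m : ℕ)
    (h : ∀ b, ∑ d ∈ Finset.range m, c d * qBinom q d b =
      ∑ d ∈ Finset.range m, c' d * qBinom q d b) :
    ∀ d < m, c d = c' d := by
  induction m with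
  | zero => simp
  | succ m ih =>
    have hz : ∀ f : ℕ → ℕ, ∑ d ∈ Finset.range m, f d * qBinom q d m = 0 := fun f =>
      Finset.sum_eq_zero fun d hd => by rw [qBinom_eq_zero q (Finset.mem_range.1 hd), mul_zero]
    have hm : c m = c' m := by
      simpa [Finset.sum_range_succ, hz] using h m
    intro d hd
    rcases Nat.lt_succ_iff_lt_or_eq.1 hd with hd | rfl
    · refine ih (fun b => ?_) d hd
      have := h b
      rw [Finset.sum_range_succ, Finset.sum_range_succ, hm] at this
      exact Nat.add_right_cancel this
    · exact hm

/-- With `N = n + 2`, the number of `a`-dimensional subspaces `W` of the vector space at vertex `1`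
of the preprojective module of dimension vector `(n + 1, n)` for which the vectors sent into `W` by
both arrows form a space of dimension `d` (see `KroneckerModule.prolongNumber_eq`). The truncated
subtractions make the formula right for all `a` and `d`, including `a = 0`. -/
def prolongCount (q N a d : ℕ) : ℕ :=
  qBinom q (N - a) (a - d) * qBinom q (a - 1) d * q ^ ((a - d) * (a - d - 1))

theorem prolongCount_eq_zero (q N : ℕ) {a d : ℕ} (h : a < d) : prolongCount q N a d = 0 := by
  rw [prolongCount, qBinom_eq_zero q (show a - 1 < d by omega), mul_zero, zero_mul]

theorem sum_range_eq_of_eq_zero {f : ℕ → ℕ} {a m : ℕ} (ham : a < m) (h : ∀ d, a < d → f d = 0) :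
    ∑ d ∈ Finset.range m, f d = ∑ d ∈ Finset.range (a + 1), f d := by
  symm
  refine Finset.sum_subset (by simpa using ham) fun d _ hd => h d ?_
  simpa using hd

/-- Choosing a `b`-dimensional subspace inside the `d`-dimensional space attached to `W` counts the
submodules of dimension vector `(a, b)`. -/
theorem sum_prolongCount_mul_qBinom {q : ℕ} (hq : 1 < q) (N a b : ℕ) {m : ℕ} (ham : a < m) :
    ∑ d ∈ Finset.range m, prolongCount q N a d * qBinom q d b =
      qBinom q (N - 1 - b) (a - b) * qBinom q (a - 1) b := by
  rw [sum_range_eq_of_eq_zero ham fun d hd => by rw [prolongCount_eq_zero q N hd, zero_mul]]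
  rcases a with _ | A
  · simp [prolongCount]
  rcases lt_or_ge A b with hb | hb
  · rw [Nat.add_sub_cancel, qBinom_eq_zero q hb, mul_zero]
    refine Finset.sum_eq_zero fun d hd => ?_
    rcases lt_or_ge d b with h | h
    · rw [qBinom_eq_zero q h, mul_zero]
    · rw [prolongCount, Nat.add_sub_cancel, qBinom_eq_zero q (show A < d by omega)]
      simp
  obtain ⟨t, rfl⟩ := Nat.exists_eq_add_of_le hb
  -- The terms with `d < b` vanish, and the others are those of a `q`-Vandermonde sum.
  rw [show b + t + 1 + 1 = b + (t + 1 + 1) by ring, Finset.sum_range_add,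
    Finset.sum_eq_zero fun d hd => by rw [qBinom_eq_zero q (Finset.mem_range.1 hd), mul_zero],
    zero_add]
  rcases lt_or_ge N (b + t + 1) with hN | hN
  · rw [qBinom_eq_zero q (show N - 1 - b < b + t + 1 - b by omega), zero_mul]
    refine Finset.sum_eq_zero fun i hi => ?_
    rw [Finset.mem_range] at hi
    rcases Nat.lt_succ_iff_lt_or_eq.1 hi with hi | rfl
    · rw [prolongCount, qBinom_eq_zero q (show N - (b + t + 1) < b + t + 1 - (b + i) by omega)]
      simp
    · rw [prolongCount, qBinom_eq_zero q (show b + t + 1 - 1 < b + (t + 1) by omega)]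
      simp
  obtain ⟨s, rfl⟩ := Nat.exists_eq_add_of_le hN
  rw [show b + t + 1 + s - 1 - b = t + s by omega, show b + t + 1 - b = t + 1 by omega,
    qBinom_add hq, Finset.Nat.sum_antidiagonal_eq_sum_range_succ_mk, Finset.sum_mul]
  refine Finset.sum_congr rfl fun i hi => ?_
  rw [Finset.mem_range] at hi
  have := qBinom_mul_qBinom hq (b + t) (Nat.le_add_right b i)
  rw [Nat.add_sub_cancel_left, Nat.add_sub_cancel_left] at this
  rw [prolongCount, Nat.add_sub_cancel, Nat.add_sub_cancel_left,
    show b + t + 1 - (b + i) = t + 1 - i by omega, show t - i = t + 1 - i - 1 by omega]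
  linear_combination
    (qBinom q s (t + 1 - i) * q ^ ((t + 1 - i) * (t + 1 - i - 1)) : ℕ) * this

/-- The same product, as a sum over the subspaces `W` at vertex `2`, of dimension `b`: if `W` spans
under both arrows a space of dimension `2 * b - d`, the last factor counts the `a`-dimensional
subspaces containing that space. -/
theorem sum_prolongCount_mul_qBinom' {q : ℕ} (hq : 1 < q) (N a b : ℕ) {m : ℕ} (hbm : b < m) :
    ∑ d ∈ Finset.range m, prolongCount q N b d *
        (if 2 * b - d ≤ a then qBinom q (N - (2 * b - d)) (a - (2 * b - d)) else 0) =
      qBinom q (N - b) (a - b) * qBinom q (a - 1) b := by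
  rw [sum_range_eq_of_eq_zero hbm fun d hd => by rw [prolongCount_eq_zero q N hd, zero_mul]]
  rcases b with _ | B
  · simp [prolongCount]
  rcases lt_or_ge a (B + 1) with ha | ha
  · rw [qBinom_eq_zero q (show a - 1 < B + 1 by omega), mul_zero]
    refine Finset.sum_eq_zero fun d hd => ?_
    rw [Finset.mem_range] at hd
    rw [if_neg (by omega), mul_zero]
  obtain ⟨t, rfl⟩ := Nat.exists_eq_add_of_le ha
  -- The trinomial identity takes the factor `[N - b, a - b]` out of each term, and a
  -- `q`-Vandermonde sum remains.
  rw [show B + 1 + t - 1 = B + t by omega, qBinom_add hq,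
    Finset.Nat.sum_antidiagonal_eq_sum_range_succ_mk, Finset.mul_sum]
  refine Finset.sum_congr rfl fun d hd => ?_
  rw [Finset.mem_range] at hd
  obtain ⟨r, hr⟩ := Nat.exists_eq_add_of_le (show d ≤ B + 1 by omega)
  rw [prolongCount, Nat.add_sub_cancel, show B + 1 - d = r by omega,
    show 2 * (B + 1) - d = B + 1 + r by omega, show B + 1 + t - (B + 1) = t by omega,
    show B - d = r - 1 by omega]
  rcases lt_or_ge t r with h | h
  · rw [if_neg (by omega), qBinom_eq_zero q h]
    simp
  · have := qBinom_mul_qBinom hq (N - (B + 1)) h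
    rw [if_pos (by omega), show N - (B + 1 + r) = N - (B + 1) - r by omega,
      show B + 1 + t - (B + 1 + r) = t - r by omega]
    linear_combination (qBinom q B d * q ^ (r * (r - 1)) : ℕ) * this.symm

/-- The integer-indexed product in terms of natural number Gaussian binomials. Whenever one of the
subtractions on the right is truncated, both sides vanish; the only exception is `a = b = 0`, where
the right hand side is `1`. -/
theorem gaussCoeff_mul_gaussCoeff {q : ℕ} (hq : 1 < q) (n a b : ℕ) (h : ¬ (a = 0 ∧ b = 0)) :
    gaussCoeff (n + 1 - a) (n + 1 - b) q * gaussCoeff (a - b - 1) (a - 1) q =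
      ((qBinom q (n + 1 - b) (a - b) * qBinom q (a - 1) b : ℕ) : ℚ) := by
  rcases le_or_gt a b with hab | hab
  · rw [gaussCoeff_eq_zero_of_neg (l := (a : ℤ) - b - 1) _ _ (by omega),
      qBinom_eq_zero q (show a - 1 < b by omega)]
    simp
  rcases lt_or_ge (n + 1) a with ha | ha
  · rw [gaussCoeff_eq_zero_of_neg (l := (n : ℤ) + 1 - a) _ _ (by omega),
      qBinom_eq_zero q (show n + 1 - b < a - b by omega)]
    simp
  obtain ⟨s, hs⟩ := Nat.exists_eq_add_of_lt hab
  obtain ⟨t, ht⟩ := Nat.exists_eq_add_of_le ha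
  have e₁ : gaussCoeff (n + 1 - a) (n + 1 - b) q = qBinom q (n + 1 - b) (a - b) := by
    rw [show (n : ℤ) + 1 - a = (t : ℕ) by omega,
      show (n : ℤ) + 1 - b = (t + (a - b) : ℕ) by omega,
      gaussCoeff_natCast hq (by omega), qBinom_symm hq, show t + (a - b) = n + 1 - b by omega]
  have e₂ : gaussCoeff (a - b - 1) (a - 1) q = qBinom q (a - 1) b := by
    rw [show (a : ℤ) - b - 1 = (s : ℕ) by omega, show (a : ℤ) - 1 = (s + b : ℕ) by omega,
      gaussCoeff_natCast hq (by omega), qBinom_symm hq, show s + b = a - 1 by omega]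
  rw [e₁, e₂, Nat.cast_mul]

/-! ### Counting subspaces over a finite field -/

/-- The number of linearly independent families of length `i` in a space of dimension `i + j`, in
terms of `q`-factorials. -/
theorem prod_pow_sub_pow (q i j : ℕ) :
    (∏ t : Fin i, ((q : ℚ) ^ (i + j) - (q : ℚ) ^ (t : ℕ))) * qFact q j =
      q ^ (∑ t ∈ Finset.range i, t) * qFact q (i + j) := by
  rw [Fin.prod_univ_eq_prod_range (fun t => (q : ℚ) ^ (i + j) - (q : ℚ) ^ t)]
  have key : ∀ s ≤ i, (∏ t ∈ Finset.range s, ((q : ℚ) ^ (i + j) - (q : ℚ) ^ t)) *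
      qFact q (i + j - s) = q ^ (∑ t ∈ Finset.range s, t) * qFact q (i + j) := by
    intro s
    induction s with
    | zero => simp
    | succ s ih =>
      intro hs
      have := ih (by omega)
      obtain ⟨r, hr⟩ := Nat.exists_eq_add_of_le (show s + 1 ≤ i + j by omega)
      rw [hr] at this ⊢
      rw [show s + 1 + r - s = r + 1 by omega, qFact_succ] at this
      rw [show s + 1 + r - (s + 1) = r by omega, Finset.prod_range_succ, Finset.sum_range_succ]
      linear_combination (q : ℚ) ^ s * this
  simpa using key i le_rfl

section Subspaces

variable {k : Type*} [Field k] [Fintype k] {V : Type*} [AddCommGroup V] [Module k V]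
  [Module.Finite k V]

/-- The linearly independent families with a given span `W` are the bases of `W`. -/
def linearIndependentSpanEquiv (j : ℕ) (W : Submodule k V) (hW : finrank k W = j) :
    {s : {s : Fin j → V // LinearIndependent k s} // Submodule.span k (Set.range s.1) = W} ≃
      {t : Fin j → W // LinearIndependent k t} where
  toFun s := ⟨fun i => ⟨s.1.1 i, s.2.le (Submodule.subset_span ⟨i, rfl⟩)⟩,
    LinearIndependent.of_comp W.subtype s.1.2⟩
  invFun t := ⟨⟨W.subtype ∘ t.1, t.2.map' W.subtype W.ker_subtype⟩, by
    refine Submodule.eq_of_le_of_finrank_eq ?_ ?_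
    · rw [Submodule.span_le]
      rintro _ ⟨i, rfl⟩
      exact (t.1 i).2
    · rw [finrank_span_eq_card (R := k) (t.2.map' W.subtype W.ker_subtype), hW, Fintype.card_fin]⟩
  left_inv _ := rfl
  right_inv _ := rfl

/-- The number of `j`-dimensional subspaces is found by counting linearly independent families of
length `j`: every subspace is the span of equally many of them. -/
theorem card_submodule_finrank_eq (j : ℕ) :
    Nat.card {W : Submodule k V // finrank k W = j} =
      qBinom (Fintype.card k) (finrank k V) j := by
  classical
  have : Finite V := Module.finite_of_finite k
  have hq : 1 < Fintype.card k := Fintype.one_lt_card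
  rcases lt_or_ge (finrank k V) j with h | h
  · rw [qBinom_eq_zero _ h, Nat.card_eq_zero]
    left
    constructor
    rintro ⟨W, rfl⟩
    exact absurd W.finrank_le (by omega)
  have : Fintype {W : Submodule k V // finrank k W = j} := Fintype.ofFinite _
  let f : {s : Fin j → V // LinearIndependent k s} → {W : Submodule k V // finrank k W = j} :=
    fun s => ⟨Submodule.span k (Set.range s.1), by
      rw [finrank_span_eq_card s.2, Fintype.card_fin]⟩
  have h₁ := Nat.card_congr (Equiv.sigmaFiberEquiv f)
  have h₂ : ∀ W : {W : Submodule k V // finrank k W = j}, Nat.card {s // f s = W} =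
      ∏ i : Fin j, (Fintype.card k ^ j - Fintype.card k ^ (i : ℕ)) := by
    rintro ⟨W, hW⟩
    have h₃ := card_linearIndependent (K := k) (V := W) hW.ge
    rw [hW] at h₃
    rw [← h₃, ← Nat.card_congr (linearIndependentSpanEquiv j W hW)]
    exact Nat.card_congr (Equiv.subtypeEquivRight fun s => Subtype.ext_iff)
  rw [Nat.card_sigma, Finset.sum_congr rfl fun W _ => h₂ W, Finset.sum_const, Finset.card_univ,
    smul_eq_mul, ← Nat.card_eq_fintype_card, card_linearIndependent h] at h₁
  obtain ⟨r, hr⟩ := Nat.exists_eq_add_of_le h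
  rw [hr] at h₁ ⊢
  generalize Fintype.card k = q at hq h₁ ⊢
  have hcast : ∀ r : ℕ, ((∏ i : Fin j, (q ^ (j + r) - q ^ (i : ℕ)) : ℕ) : ℚ) * qFact q r =
      q ^ (∑ t ∈ Finset.range j, t) * qFact q (j + r) := by
    intro r
    rw [← prod_pow_sub_pow, Nat.cast_prod]
    congr 1
    refine Finset.prod_congr rfl fun i _ => ?_
    rw [Nat.cast_sub (Nat.pow_le_pow_right (by omega) (by omega))]
    push_cast
    rfl
  have h₄ := hcast 0
  have h₅ := hcast r
  rw [← h₁, Nat.cast_mul] at h₅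
  simp only [add_zero, qFact_zero, mul_one] at h₄
  rw [h₄, ← qBinom_mul_qFact q j r] at h₅
  have e₁ := qFact_ne_zero hq j
  have e₂ := qFact_ne_zero hq r
  have e₃ : (q : ℚ) ^ (∑ t ∈ Finset.range j, t) ≠ 0 := pow_ne_zero _ (by
    exact_mod_cast (show q ≠ 0 by omega))
  have : ((Nat.card {W : Submodule k V // finrank k W = j} : ℕ) : ℚ) = qBinom q (j + r) j := by
    apply mul_right_cancel₀ (mul_ne_zero (mul_ne_zero e₃ e₁) e₂)
    linear_combination h₅
  exact_mod_cast this

theorem card_submodule_le_finrank_eq (U : Submodule k V) (j : ℕ) :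
    Nat.card {W : Submodule k V // W ≤ U ∧ finrank k W = j} =
      qBinom (Fintype.card k) (finrank k U) j := by
  rw [← card_submodule_finrank_eq]
  symm
  refine Nat.card_congr (((Submodule.MapSubtype.orderIso U).toEquiv.subtypeEquiv
    (q := fun W => finrank k W.1 = j) fun W => ?_).trans
    (Equiv.subtypeSubtypeEquivSubtypeInter (fun W => W ≤ U) fun W => finrank k W = j))
  change _ ↔ finrank k (W.map U.subtype) = j
  rw [Submodule.finrank_map_subtype_eq]

theorem card_submodule_ge_finrank_eq (U : Submodule k V) (j : ℕ) :
    Nat.card {W : Submodule k V // U ≤ W ∧ finrank k W = j} =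
      if finrank k U ≤ j then qBinom (Fintype.card k) (finrank k V - finrank k U)
        (j - finrank k U) else 0 := by
  split_ifs with h
  · have hV := U.finrank_quotient_add_finrank
    rw [show finrank k V - finrank k U = finrank k (V ⧸ U) by omega, ← card_submodule_finrank_eq]
    symm
    let e : {W : Submodule k (V ⧸ U) // finrank k W = j - finrank k U} ≃
        {W : {W : Submodule k V // U ≤ W} // finrank k W.1 = j} :=
      (Submodule.comapMkQRelIso U).toEquiv.subtypeEquiv (q := fun W => finrank k W.1 = j)
        fun W => ?_
    refine Nat.card_congr (e.trans
      (Equiv.subtypeSubtypeEquivSubtypeInter (fun W => U ≤ W) fun W => finrank k W = j))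
    change _ ↔ finrank k (W.comap U.mkQ) = j
    have h₁ := LinearMap.finrank_range_add_finrank_ker (U.mkQ.domRestrict (W.comap U.mkQ))
    have hU : U ≤ W.comap U.mkQ := Submodule.le_comap_mkQ U W
    rw [LinearMap.range_domRestrict, Submodule.map_comap_eq_of_surjective U.mkQ_surjective,
      LinearMap.ker_domRestrict, Submodule.ker_mkQ,
      (Submodule.comapSubtypeEquivOfLe hU).finrank_eq] at h₁
    omega
  · rw [Nat.card_eq_zero]
    left
    constructor
    rintro ⟨W, hW, rfl⟩
    exact h (Submodule.finrank_mono hW)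

end Subspaces

/-! ### The reflection functor -/

namespace KroneckerModule

variable {k : Type u} [Field k]

/-- The reflection functor at the sink: the new vertices carry `V₂` and the kernel of
`(α, β) : V₂ × V₂ → V₁`, and the new arrows are the two coordinate projections. -/
def reflection (M : KroneckerModule.{u, v} k) : KroneckerModule.{u, v} k where
  V₁ := M.V₂
  V₂ := LinearMap.ker (M.α.coprod M.β)
  α := LinearMap.fst k M.V₂ M.V₂ ∘ₗ Submodule.subtype _
  β := LinearMap.snd k M.V₂ M.V₂ ∘ₗ Submodule.subtype _

/-- The space of all vectors at vertex `2` that both arrows send into `W`. -/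
def preimage (M : KroneckerModule.{u, v} k) (W : Submodule k M.V₁) : Submodule k M.V₂ :=
  W.comap M.α ⊓ W.comap M.β

/-- The space spanned by the images of `W` under the two arrows. -/
def image (M : KroneckerModule.{u, v} k) (W : Submodule k M.V₂) : Submodule k M.V₁ :=
  W.map M.α ⊔ W.map M.β

theorem image_le_iff (M : KroneckerModule.{u, v} k) (W₁ : Submodule k M.V₁)
    (W₂ : Submodule k M.V₂) : M.image W₂ ≤ W₁ ↔ W₂ ≤ M.preimage W₁ := by
  rw [image, preimage, sup_le_iff, le_inf_iff, Submodule.map_le_iff_le_comap,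
    Submodule.map_le_iff_le_comap]

theorem map_prod_coprod (M : KroneckerModule.{u, v} k) (W W' : Submodule k M.V₂) :
    (W.prod W').map (M.α.coprod M.β) = W.map M.α ⊔ W'.map M.β :=
  LinearMap.map_coprod_prod ..

theorem finrank_image_add_finrank_preimage (M : KroneckerModule.{u, v} k)
    (W : Submodule k M.V₂) :
    finrank k (M.image W) + finrank k (M.reflection.preimage W) = 2 * finrank k W := by
  have h := LinearMap.finrank_range_add_finrank_ker ((M.α.coprod M.β).domRestrict (W.prod W))
  rw [LinearMap.range_domRestrict, map_prod_coprod, LinearMap.ker_domRestrict,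
    ← Submodule.finrank_map_subtype_eq, Submodule.map_comap_subtype] at h
  have h₁ : finrank k (M.reflection.preimage W) =
      finrank k (W.prod W ⊓ LinearMap.ker (M.α.coprod M.β) : Submodule k (M.V₂ × M.V₂)) := by
    rw [inf_comm, ← Submodule.map_comap_subtype, Submodule.finrank_map_subtype_eq]
    rfl
  have h₂ : finrank k (W.prod W) = 2 * finrank k W := by
    have e := LinearMap.finrank_range_of_inj (f := W.subtype.prodMap W.subtype)
      (Prod.map_injective.2 ⟨W.injective_subtype, W.injective_subtype⟩)
    rwa [LinearMap.range_prodMap, Submodule.range_subtype, Module.finrank_prod, ← two_mul] at e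
  rw [h₁, image, h, h₂]

theorem IsIndecomposable.image_top {M : KroneckerModule.{u, v} k} (hM : M.IsIndecomposable)
    [Nontrivial M.V₂] : M.image ⊤ = ⊤ := by
  obtain ⟨C, hC⟩ := (M.image ⊤).exists_isCompl
  have hle := (M.image_le_iff _ _).1 (le_refl (M.image ⊤))
  rcases hM.2 ⟨M.image ⊤, ⊤, fun x hx => (hle hx).1, fun x hx => (hle hx).2⟩
    ⟨C, ⊥, by simp, by simp⟩ ⟨hC, isCompl_top_bot⟩ with h' | h'
  · exact absurd h'.2 top_ne_bot
  · have : C = ⊥ := h'.1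
    rw [this] at hC
    exact eq_top_of_isCompl_bot hC

theorem dimVector_reflection {M : KroneckerModule.{u, v} k} {n : ℕ} (hM : M.IsIndecomposable)
    (h : M.dimVector = (n + 2, n + 1)) : M.reflection.dimVector = (n + 1, n) := by
  have h₁ : finrank k M.V₁ = n + 2 := congrArg Prod.fst h
  have h₂ : finrank k M.V₂ = n + 1 := congrArg Prod.snd h
  have : Nontrivial M.V₂ := Module.nontrivial_of_finrank_pos (R := k) (by omega)
  have := M.finrank_image_add_finrank_preimage ⊤
  have e : finrank k (M.reflection.preimage (⊤ : Submodule k M.V₂)) =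
      finrank k M.reflection.V₂ := by
    have : M.reflection.preimage (⊤ : Submodule k M.V₂) = ⊤ := inf_top_eq _
    rw [this, finrank_top]
  rw [hM.image_top, finrank_top, finrank_top, h₁, h₂, e] at this
  exact Prod.ext h₂ (by change finrank k M.reflection.V₂ = n; omega)

theorem finrank_image_add_finrank_le (M : KroneckerModule.{u, v} k) (N : M.reflection.Sub)
    {A : Submodule k M.V₂} (hA : N.W₁ = A) :
    finrank k (M.image A) + finrank k N.W₂ ≤ 2 * finrank k A := by
  have hle : N.W₂ ≤ M.reflection.preimage A :=
    fun x hx => ⟨hA.le (N.map_α x hx), hA.le (N.map_β x hx)⟩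
  have := M.finrank_image_add_finrank_preimage A
  have := Submodule.finrank_mono hle
  omega

/-- A decomposition of the reflection into pairs `(A, K)`, `(A', K')` yields the decomposition of
the module into `(image A, A)`, `(image A', A')`: the images span `V₁`, and they are independent
for reasons of dimension. -/
theorem IsIndecomposable.reflection {M : KroneckerModule.{u, v} k} {n : ℕ}
    (hM : M.IsIndecomposable) (h : M.dimVector = (n + 2, n + 1)) :
    M.reflection.IsIndecomposable := by
  have hd := dimVector_reflection hM h
  have h₁ : finrank k M.V₁ = n + 2 := congrArg Prod.fst h
  have h₂ : finrank k M.V₂ = n + 1 := congrArg Prod.snd h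
  have h₃ : finrank k M.reflection.V₂ = n := congrArg Prod.snd hd
  have : Nontrivial M.V₂ := Module.nontrivial_of_finrank_pos (R := k) (by omega)
  refine ⟨Or.inl ‹_›, fun N N' hN => ?_⟩
  obtain ⟨A, hA⟩ : ∃ A : Submodule k M.V₂, N.W₁ = A := ⟨_, rfl⟩
  obtain ⟨A', hA'⟩ : ∃ A : Submodule k M.V₂, N'.W₁ = A := ⟨_, rfl⟩
  have hAA' : IsCompl A A' := by
    have := hN.1
    rwa [hA, hA'] at this
  have hsup : M.image A ⊔ M.image A' = ⊤ := by
    rw [← hM.image_top, ← hAA'.sup_eq_top, image, image, image, Submodule.map_sup,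
      Submodule.map_sup, sup_sup_sup_comm]
  have hcompl : IsCompl (M.image A) (M.image A') := by
    refine ⟨?_, codisjoint_iff.2 hsup⟩
    rw [disjoint_iff, ← Submodule.finrank_eq_zero (R := k)]
    have e₁ := Submodule.finrank_sup_add_finrank_inf_eq (M.image A) (M.image A')
    rw [hsup, finrank_top, h₁] at e₁
    have e₂ := M.finrank_image_add_finrank_le N hA
    have e₃ := M.finrank_image_add_finrank_le N' hA'
    have e₄ := Submodule.finrank_add_eq_of_isCompl hAA'
    have e₅ := Submodule.finrank_add_eq_of_isCompl hN.2
    omega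
  have hzero : ∀ N : M.reflection.Sub, N.W₁ = (⊥ : Submodule k M.V₂) → N.IsZero := by
    intro N hN
    refine ⟨hN, ?_⟩
    have e := M.finrank_image_add_finrank_le N hN
    rw [finrank_bot] at e
    exact Submodule.finrank_eq_zero.1 (by omega)
  have hsub : ∀ A : Submodule k M.V₂, A ≤ M.preimage (M.image A) :=
    fun A => (M.image_le_iff _ _).1 le_rfl
  rcases hM.2 ⟨M.image A, A, fun x hx => (hsub _ hx).1, fun x hx => (hsub _ hx).2⟩
    ⟨M.image A', A', fun x hx => (hsub _ hx).1, fun x hx => (hsub _ hx).2⟩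
    ⟨hcompl, hAA'⟩ with h' | h'
  · exact Or.inl (hzero N (hA.trans h'.2))
  · exact Or.inr (hzero N' (hA'.trans h'.2))

/-! ### Counting submodules -/

/-- The number of `a`-dimensional subspaces at vertex `1` for which the vectors sent into them by
both arrows form a space of dimension `d`. -/
noncomputable def prolongNumber (M : KroneckerModule.{u, v} k) (a d : ℕ) : ℕ :=
  Nat.card {W : {W : Submodule k M.V₁ // finrank k W = a} // finrank k (M.preimage W.1) = d}

/-- The submodules of dimension vector `(a, b)`, fibred over the subspace at vertex `1`. -/
def grassmannianEquivSigma₁ (M : KroneckerModule.{u, v} k) (a b : ℕ) : M.grassmannian a b ≃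
    Σ W₁ : {W : Submodule k M.V₁ // finrank k W = a},
      {W₂ : Submodule k M.V₂ // W₂ ≤ M.preimage W₁ ∧ finrank k W₂ = b} where
  toFun N := ⟨⟨N.1.W₁, Nat.cast_injective N.2.1⟩, N.1.W₂,
    fun x hx => ⟨N.1.map_α x hx, N.1.map_β x hx⟩, Nat.cast_injective N.2.2⟩
  invFun p := ⟨⟨p.1.1, p.2.1, fun _ hx => (p.2.2.1 hx).1, fun _ hx => (p.2.2.1 hx).2⟩,
    congrArg Nat.cast p.1.2, congrArg Nat.cast p.2.2.2⟩
  left_inv _ := rfl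
  right_inv _ := rfl

/-- The submodules of dimension vector `(a, b)`, fibred over the subspace at vertex `2`. -/
def grassmannianEquivSigma₂ (M : KroneckerModule.{u, v} k) (a b : ℕ) : M.grassmannian a b ≃
    Σ W₂ : {W : Submodule k M.V₂ // finrank k W = b},
      {W₁ : Submodule k M.V₁ // M.image W₂ ≤ W₁ ∧ finrank k W₁ = a} where
  toFun N := ⟨⟨N.1.W₂, Nat.cast_injective N.2.2⟩, N.1.W₁,
    (M.image_le_iff _ _).2 fun x hx => ⟨N.1.map_α x hx, N.1.map_β x hx⟩,
    Nat.cast_injective N.2.1⟩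
  invFun p := ⟨⟨p.2.1, p.1.1, fun _ hx => ((M.image_le_iff _ _).1 p.2.2.1 hx).1,
    fun _ hx => ((M.image_le_iff _ _).1 p.2.2.1 hx).2⟩,
    congrArg Nat.cast p.2.2.2, congrArg Nat.cast p.1.2⟩
  left_inv _ := rfl
  right_inv _ := rfl

theorem _root_.sum_comp_eq_sum_card_mul {X : Type*} [Fintype X] (c : X → ℕ) (g : ℕ → ℕ) {m : ℕ}
    (hm : ∀ x, c x < m) :
    ∑ x, g (c x) = ∑ d ∈ Finset.range m, Nat.card {x // c x = d} * g d := by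
  classical
  rw [← Finset.sum_fiberwise_of_maps_to (s := Finset.univ) (t := Finset.range m) (g := c)
    fun x _ => Finset.mem_range.2 (hm x)]
  refine Finset.sum_congr rfl fun d _ => ?_
  rw [Finset.sum_congr rfl fun x hx => by rw [(Finset.mem_filter.1 hx).2], Finset.sum_const,
    smul_eq_mul, Nat.card_eq_fintype_card, Fintype.card_subtype]

variable [Fintype k]

theorem finite_grassmannian (M : KroneckerModule.{u, v} k) (a b : ℤ) :
    (M.grassmannian a b).Finite := by
  have : Finite M.V₁ := Module.finite_of_finite k
  have : Finite M.V₂ := Module.finite_of_finite k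
  have : Finite M.Sub := Finite.of_injective (fun N => (N.W₁, N.W₂)) fun N N' h => by
    cases N; cases N'; simpa using h
  exact Set.toFinite _

/-- Counting submodules through their subspace at vertex `1`. -/
theorem ncard_grassmannian_eq_sum (M : KroneckerModule.{u, v} k) (a b : ℕ) {m : ℕ}
    (hm : finrank k M.V₂ < m) :
    (M.grassmannian a b).ncard =
      ∑ d ∈ Finset.range m, M.prolongNumber a d * qBinom (Fintype.card k) d b := by
  have : Finite M.V₁ := Module.finite_of_finite k
  have : Finite M.V₂ := Module.finite_of_finite k
  have : Fintype {W : Submodule k M.V₁ // finrank k W = a} := Fintype.ofFinite _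
  rw [← Nat.card_coe_set_eq, Nat.card_congr (M.grassmannianEquivSigma₁ a b), Nat.card_sigma,
    Finset.sum_congr rfl fun W _ => card_submodule_le_finrank_eq (M.preimage W.1) b]
  exact sum_comp_eq_sum_card_mul
    (fun W : {W : Submodule k M.V₁ // finrank k W = a} => finrank k (M.preimage W.1))
    (fun d => qBinom (Fintype.card k) d b) fun W => (Submodule.finrank_le _).trans_lt hm

/-- Counting submodules through their subspace `W` at vertex `2`: the dimension of the span of the
images of `W` is determined by the dimension of the preimage of `W` in the reflection. -/
theorem ncard_grassmannian_eq_sum_reflection (M : KroneckerModule.{u, v} k) (a b : ℕ) {m : ℕ}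
    (hm : finrank k M.reflection.V₂ < m) :
    (M.grassmannian a b).ncard = ∑ d ∈ Finset.range m, M.reflection.prolongNumber b d *
      (if 2 * b - d ≤ a then qBinom (Fintype.card k) (finrank k M.V₁ - (2 * b - d))
        (a - (2 * b - d)) else 0) := by
  have : Finite M.V₁ := Module.finite_of_finite k
  have : Finite M.V₂ := Module.finite_of_finite k
  have : Fintype {W : Submodule k M.V₂ // finrank k W = b} := Fintype.ofFinite _
  rw [← Nat.card_coe_set_eq, Nat.card_congr (M.grassmannianEquivSigma₂ a b), Nat.card_sigma,
    Finset.sum_congr rfl fun W _ => card_submodule_ge_finrank_eq (M.image W.1) a]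
  rw [Finset.sum_congr rfl fun W _ => by
    rw [show finrank k (M.image W.1) = 2 * b - finrank k (M.reflection.preimage W.1) by
      have := M.finrank_image_add_finrank_preimage W.1
      rw [W.2] at this
      omega]]
  exact sum_comp_eq_sum_card_mul
    (fun W : {W : Submodule k M.V₂ // finrank k W = b} => finrank k (M.reflection.preimage W.1))
    (fun d => if 2 * b - d ≤ a then qBinom (Fintype.card k) (finrank k M.V₁ - (2 * b - d))
        (a - (2 * b - d)) else 0) fun W => (Submodule.finrank_le _).trans_lt hm

/-- If the count of submodules is as expected for all dimension vectors, then so are the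
`prolongNumber`s, by `q`-binomial inversion. -/
theorem prolongNumber_eq (M : KroneckerModule.{u, v} k) {n : ℕ} (a : ℕ)
    (h : ∀ b : ℕ, (M.grassmannian a b).ncard =
      qBinom (Fintype.card k) (n + 1 - b) (a - b) * qBinom (Fintype.card k) (a - 1) b) (d : ℕ) :
    M.prolongNumber a d = prolongCount (Fintype.card k) (n + 2) a d := by
  refine eq_of_sum_mul_qBinom_eq (Fintype.card k) _ _ (finrank k M.V₂ + a + d + 1)
    (fun b => ?_) d (by omega)
  rw [← M.ncard_grassmannian_eq_sum a b (by omega), h,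
    sum_prolongCount_mul_qBinom Fintype.one_lt_card _ _ _ (by omega)]
  rfl

theorem ncard_grassmannian {n : ℕ} (M : KroneckerModule.{u, v} k) (hM : M.IsIndecomposable)
    (h : M.dimVector = (n + 1, n)) (a b : ℕ) :
    (M.grassmannian a b).ncard =
      qBinom (Fintype.card k) (n + 1 - b) (a - b) * qBinom (Fintype.card k) (a - 1) b := by
  induction n generalizing M a b with
  | zero =>
    have h₁ : finrank k M.V₁ = 1 := congrArg Prod.fst h
    have h₂ : finrank k M.V₂ = 0 := congrArg Prod.snd h
    have hp : ∀ d, 0 < d → M.prolongNumber a d = 0 := by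
      intro d hd
      rw [prolongNumber, Nat.card_eq_zero]
      left
      constructor
      rintro ⟨W, hW⟩
      have := (M.preimage W.1).finrank_le
      omega
    have hp₀ : M.prolongNumber a 0 = qBinom (Fintype.card k) 1 a := by
      rw [← h₁, ← card_submodule_finrank_eq, prolongNumber]
      refine Nat.card_congr (Equiv.subtypeUnivEquiv fun W => ?_)
      have := (M.preimage W.1).finrank_le
      omega
    rw [M.ncard_grassmannian_eq_sum a b (m := 1) (by omega), Finset.sum_range_one, hp₀]
    rcases b with _ | b
    · simp
    · rcases le_or_gt a (b + 1) with hab | hab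
      · rw [qBinom_eq_zero _ (show a - 1 < b + 1 by omega)]
        simp
      · rw [qBinom_eq_zero _ (show 0 + 1 - (b + 1) < a - (b + 1) by omega)]
        simp
  | succ n ih =>
    have hd := dimVector_reflection hM h
    have h₁ : finrank k M.V₁ = n + 2 := congrArg Prod.fst h
    rw [M.ncard_grassmannian_eq_sum_reflection a b (m := finrank k M.reflection.V₂ + b + 1)
      (by omega), h₁]
    rw [Finset.sum_congr rfl fun d _ => by
      rw [M.reflection.prolongNumber_eq b (fun b' => ih M.reflection (hM.reflection h) hd b b') d]]
    exact sum_prolongCount_mul_qBinom' Fintype.one_lt_card _ _ _ (by omega)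

end KroneckerModule

/-! ### The module of polynomials -/

namespace KroneckerModule

open Polynomial

/-- The Kronecker module of polynomials of degree `< n + 1` and of degree `< n`, with the inclusion
and the multiplication by `X` as arrows. -/
noncomputable def polynomialModule (k : Type u) [Field k] (n : ℕ) : KroneckerModule.{u, u} k where
  V₁ := degreeLT k (n + 1)
  V₂ := degreeLT k n
  α := Submodule.inclusion (degreeLT_mono n.le_succ)
  β := (LinearMap.mulLeft k X).restrict fun p hp => by
    rw [mem_degreeLT] at hp ⊢
    rcases eq_or_ne p 0 with rfl | h
    · simp
    · rw [LinearMap.mulLeft_apply, degree_eq_natDegree (mul_ne_zero X_ne_zero h),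
        natDegree_X_mul h]
      rw [degree_eq_natDegree h] at hp
      have := Nat.cast_lt.1 hp
      exact_mod_cast Nat.succ_lt_succ this

variable {k : Type u} [Field k]

theorem dimVector_polynomialModule (n : ℕ) : (polynomialModule k n).dimVector = (n + 1, n) := by
  have h : ∀ n, finrank k (degreeLT k n) = n := fun n => by
    rw [(degreeLTEquiv k n).finrank_eq, finrank_fin_fun]
  exact Prod.ext (h _) (h _)

/-- Let `V₁` and `V₂` be embedded into `k[X]` in such a way that `α` is the inclusion and `β` is
the multiplication by `X`. If `dim W₁ ≤ dim W₂`, then `W₁ = W₂` as spaces of polynomials, so `W₂` is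
stable under multiplication by `X`; as its elements have bounded degree, `W₂ = 0`. -/
theorem Sub.finrank_lt_finrank {M : KroneckerModule.{u, v} k} (ι₁ : M.V₁ →ₗ[k] k[X])
    (ι₂ : M.V₂ →ₗ[k] k[X]) (hι₂ : Function.Injective ι₂)
    (hα : ∀ x, ι₁ (M.α x) = ι₂ x) (hβ : ∀ x, ι₁ (M.β x) = X * ι₂ x) {n : ℕ}
    (hn : ∀ x, ι₂ x ∈ degreeLT k n) (N : M.Sub) (hN : ¬ N.IsZero) :
    finrank k N.W₂ < finrank k N.W₁ := by
  by_contra! hle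
  have hinj : Function.Injective M.α := fun x y h => hι₂ (by rw [← hα, ← hα, h])
  have hmap : N.W₂.map M.α = N.W₁ := by
    refine Submodule.eq_of_le_of_finrank_le (Submodule.map_le_iff_le_comap.2 N.map_α) ?_
    rwa [← (Submodule.equivMapOfInjective _ hinj N.W₂).finrank_eq]
  have hpow : ∀ m : ℕ, ∀ x ∈ N.W₂, ∃ y ∈ N.W₂, ι₂ y = X ^ m * ι₂ x := by
    intro m x hx
    induction m with
    | zero => exact ⟨x, hx, by simp⟩
    | succ m ih =>
      obtain ⟨y, hy, hxy⟩ := ih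
      have := N.map_β y hy
      rw [← hmap] at this
      obtain ⟨z, hz, hyz⟩ := this
      exact ⟨z, hz, by rw [← hα, hyz, hβ, hxy]; ring⟩
  have h₂ : N.W₂ = ⊥ := by
    rw [Submodule.eq_bot_iff]
    intro x hx
    obtain ⟨y, -, hxy⟩ := hpow n x hx
    by_contra hx0
    have hx' : ι₂ x ≠ 0 := fun h => hx0 (hι₂ (h.trans (map_zero ι₂).symm))
    have hy := mem_degreeLT.1 (hn y)
    rw [hxy, degree_eq_natDegree (mul_ne_zero (pow_ne_zero _ X_ne_zero) hx'),
      natDegree_X_pow_mul _ hx', Nat.cast_lt] at hy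
    omega
  refine hN ⟨?_, h₂⟩
  rw [← hmap, h₂, Submodule.map_bot]

theorem finrank_lt_finrank_of_sub_polynomialModule {n : ℕ} (N : (polynomialModule k n).Sub)
    (hN : ¬ N.IsZero) : finrank k N.W₂ < finrank k N.W₁ :=
  N.finrank_lt_finrank (degreeLT k (n + 1)).subtype (degreeLT k n).subtype
    (Submodule.injective_subtype _) (Submodule.coe_inclusion (degreeLT_mono n.le_succ))
    (fun _ => rfl) (fun x => Subtype.property x) hN

theorem isIndecomposable_polynomialModule (n : ℕ) : (polynomialModule k n).IsIndecomposable := by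
  have h := dimVector_polynomialModule (k := k) n
  have h₁ : finrank k (polynomialModule k n).V₁ = n + 1 := congrArg Prod.fst h
  have h₂ : finrank k (polynomialModule k n).V₂ = n := congrArg Prod.snd h
  refine ⟨Or.inl (Module.nontrivial_of_finrank_pos (R := k) (by omega)), fun N N' hN => ?_⟩
  by_contra! hz
  have e₁ := finrank_lt_finrank_of_sub_polynomialModule N hz.1
  have e₂ := finrank_lt_finrank_of_sub_polynomialModule N' hz.2
  have e₃ := Submodule.finrank_add_eq_of_isCompl hN.1
  have e₄ := Submodule.finrank_add_eq_of_isCompl hN.2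
  omega

end KroneckerModule

theorem theorem4p1 {k : Type u} [Field k] [Fintype k] (n : ℕ) :
    (∃ P : KroneckerModule.{u, u} k, P.IsIndecomposable ∧ P.dimVector = (n + 1, n)) ∧
    ∀ P : KroneckerModule.{u, v} k, P.IsIndecomposable → P.dimVector = (n + 1, n) →
      ∀ a b : ℤ,
        (P.grassmannian a b).Finite ∧
        ((P.grassmannian a b).ncard : ℚ) =
          if a < 0 ∨ b < 0 then 0
          else if a = 0 ∧ b = 0 then 1
          else gaussCoeff (n + 1 - a) (n + 1 - b) (Fintype.card k) *
            gaussCoeff (a - b - 1) (a - 1) (Fintype.card k) := by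
  refine ⟨⟨.polynomialModule k n, KroneckerModule.isIndecomposable_polynomialModule n,
    KroneckerModule.dimVector_polynomialModule n⟩, fun P hP hd a b =>
      ⟨P.finite_grassmannian a b, ?_⟩⟩
  split_ifs with h h'
  · have : P.grassmannian a b = ∅ := by
      refine Set.eq_empty_of_forall_notMem fun N hN => ?_
      obtain ⟨h₁, h₂⟩ := hN
      omega
    rw [this, Set.ncard_empty, Nat.cast_zero]
  · obtain ⟨rfl, rfl⟩ := h'
    have := P.ncard_grassmannian hP hd 0 0
    simp only [Nat.cast_zero] at this
    rw [this]
    simp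
  · lift a to ℕ using by omega
    lift b to ℕ using by omega
    rw [P.ncard_grassmannian hP hd, gaussCoeff_mul_gaussCoeff Fintype.one_lt_card n a b (by omega)]
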